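/- **Setting.** A packing LP $\mathcal L=(A,b,c)$ with $n\ge 1$ variables and $m\ge 1$ constraints is $$\max \sum_{j=1}^n c_jx_j\quad\text{s.t.}\quad \sum_{j=1}^n a_{ij}x_j\le b_i\ (i\in[m]),\qquad 0\le x_j\le 1\ (j\in[n]),$$ with $A\in[0,1]^{m\times n}$, $b\in\mathbb R^m_{\ge0}$, $c\in\mathbb R^n_{\ge 0}$; put $B=\min_i b_i$. Let $\mathcal{IL}$ be the integer program with the same data and $x_j\in\{0,1\}$. A feasible $x$ is a $\rho$-approximation if its objective value is at least $\rho$ times the optimal value. A dual solution is $[\phi,\psi]\in\mathbb R^m_{\ge0}\times\mathbb R^n_{\ge0}$ with $\sum_i a_{ij}\phi_i+\psi_j\ge c_j$ for all $j$. An algorithm $\mathcal A$ is a $(1,\alpha_d)$-approximation algorithm for packing LPs ($\alpha_d\ge1$) if on every packing LP it returns a primal feasible $x$ and a dual feasible $[\phi,\psi]$ such that: $x_j>0$ implies $\sum_i a_{ij}\phi_i+\psi_j=c_j$; $\phi_i>0$ implies $b_i/\alpha_d\le\sum_j a_{ij}x_j\le b_i$; $\psi_j>0$ implies $1/\alpha_d\le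 x_j\le 1$. **Algorithm 1** (with parameters $\epsilon_s,\epsilon$). Choose a set $S\subseteq[n]$ of $s=\lceil\epsilon_s n\rceil$ variables uniformly at random. Run $\mathcal A$ on the sample LP: maximize $\sum_{j\in S}c_jx_j$ subject to $\sum_{j\in S}a_{ij}x_j\le\frac{(1-\epsilon)\epsilon_s}{\alpha_d}b_i$ $(i\in[m])$ and $x_j\in[0,1]$ $(j\in S)$, to obtain the row prices $\phi\in\mathbb R^m$. Return $\hat x\in\mathbb R^n$, where $\hat x_j=1$ if $\sum_i a_{ij}\phi_i<c_j$ and $\hat x_j=0$ otherwise. **Running time.** Algorithms are computation trees over the reals: on $p$ processors, in each round every processor performs one arithmetic operation or comparison on input numbers and previously computed values, and the time is the number of rounds ($p=1$ is the sequential case). Drawing the sample is charged one step per selected variable, i.e. $\lceil s/p\rceil$ rounds. **Statement.** Let $\mathcal A$ be a $(1,\alpha_d)$-approximation algorithm for packing LPs with runtime at most $f(n,m)$ on one processor. Let $0<\epsilon_s\le1$ with $\epsilon_sn$ an integer, let $\epsilon_f>0$, and assume $2\alpha_d^4+\alpha_d^2\,\epsilon_f/3\le 3$. Let $\mathcal L$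 be a packing LP with $B>0$, $$\epsilon_f\ \ge\ 3\sqrt{\frac{6(m+2)\log n}{\epsilon_sB}},$$ and such that for every $\phi\in\mathbb R^m_{\ge0}$ at most $m$ indices $j$ satisfy $\sum_i a_{ij}\phi_i=c_j$. Run Algorithm 1 on $\mathcal L$ with parameters $\epsilon_s$ and $\epsilon=\epsilon_f/3$. 1. The output is always integral ($\hat x\in\{0,1\}^n$), and with probability at least $1-\frac1n$ over the choice of $S$ it is a feasible $\frac{1-\epsilon_f}{\alpha_d^2}$-approximation to the optimal solution of $\mathcal{IL}$ and of $\mathcal L$. Algorithm 1 can be executed in time $f(\epsilon_sn,m)+O(n)$ for fixed $m$. 2. If $\mathcal A$ is a parallel algorithm which on $p\ge 1$ processors has runtime at most $f_p(n,m)$, the same guarantees hold for Algorithm 1 executed on $p$ processors, in time $f_p(\epsilon_sn,m)+O(\lceil n/p\rceil)$ for fixed $m$ (that is, $O(n/p)$ when $p\le n$). In both time bounds the implied constant is an absolute constant times $m$. -/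

import Mathlib

/-! ## Packing linear programs and their duals -/

/-- Data `(A, b, c)` of the program `max ∑ c_j x_j` subject to `∑_j a_ij x_j ≤ b_i` for `i ∈ [m]`
and `0 ≤ x_j ≤ 1` for `j ∈ [n]`. -/
structure LPData (n m : ℕ) where
  A : Fin m → Fin n → ℝ
  b : Fin m → ℝ
  c : Fin n → ℝ

namespace LPData

variable {n m : ℕ}

/-- The program is a packing program: `A ∈ [0,1]^{m × n}`, `b ≥ 0`, `c ≥ 0`. -/
structure IsPacking (L : LPData n m) : Prop where
  A_nonneg : ∀ i j, 0 ≤ L.A i j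
  A_le_one : ∀ i j, L.A i j ≤ 1
  b_nonneg : ∀ i, 0 ≤ L.b i
  c_nonneg : ∀ j, 0 ≤ L.c j

/-- The objective function. -/
def value (L : LPData n m) (x : Fin n → ℝ) : ℝ := ∑ j, L.c j * x j

/-- Feasible points of the linear program. -/
def feasible (L : LPData n m) : Set (Fin n → ℝ) :=
  {x | (∀ i, ∑ j, L.A i j * x j ≤ L.b i) ∧ ∀ j, 0 ≤ x j ∧ x j ≤ 1}

/-- Feasible points of the integer program with the same data. -/
def intFeasible (L : LPData n m) : Set (Fin n → ℝ) :=
  {x | x ∈ L.feasible ∧ ∀ j, x j = 0 ∨ x j = 1}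

/-- `x` lies in `F`, and its objective value is at least `ρ` times the optimal value over `F`
(the optimum being attained). -/
def IsApproxOver (L : LPData n m) (F : Set (Fin n → ℝ)) (ρ : ℝ) (x : Fin n → ℝ) : Prop :=
  x ∈ F ∧ ∃ opt : ℝ, IsGreatest (L.value '' F) opt ∧ ρ * opt ≤ L.value x

/-- Feasible points `[φ, ψ]` of the dual program: `φ` prices the rows, `ψ` the bounds `x_j ≤ 1`. -/
def DualFeasible (L : LPData n m) (φ : Fin m → ℝ) (ψ : Fin n → ℝ) : Prop :=
  (∀ i, 0 ≤ φ i) ∧ (∀ j, 0 ≤ ψ j) ∧ ∀ j, L.c j ≤ (∑ i, L.A i j * φ i) + ψ j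

/-- A primal and a dual feasible solution satisfying the primal approximate complementary slackness
conditions with factor `αp` and the dual ones with factor `αd`.  The bounds `x_j ≤ 1` are
constraints of the program, with dual variables `ψ_j`. -/
structure ApproxCompSlack (L : LPData n m) (αp αd : ℝ)
    (x : Fin n → ℝ) (φ : Fin m → ℝ) (ψ : Fin n → ℝ) : Prop where
  primal_feasible : x ∈ L.feasible
  dual_feasible : L.DualFeasible φ ψ
  primal_slack : ∀ j, 0 < x j →
    L.c j ≤ (∑ i, L.A i j * φ i) + ψ j ∧ (∑ i, L.A i j * φ i) + ψ j ≤ αp * L.c j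
  dual_slack_row : ∀ i, 0 < φ i →
    L.b i / αd ≤ ∑ j, L.A i j * x j ∧ ∑ j, L.A i j * x j ≤ L.b i
  dual_slack_bound : ∀ j, 0 < ψ j → 1 / αd ≤ x j ∧ x j ≤ 1

/-- `B = min_i b_i` (used for `m ≥ 1`). -/
noncomputable def minB (L : LPData n m) : ℝ := ⨅ i, L.b i

/-- For all dual prices, at most `m` columns satisfy `φᵀ a_j = c_j`. -/
def GeneralPosition (L : LPData n m) : Prop :=
  ∀ φ : Fin m → ℝ, (∀ i, 0 ≤ φ i) → Nat.card {j : Fin n // ∑ i, L.A i j * φ i = L.c j} ≤ m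

end LPData

/-! ## Real-number computations on `p` processors

A program is a computation tree over the reals.  In every round each of the `p` processors performs
one arithmetic operation or comparison, whose operands are input numbers or values computed in
earlier rounds (by any processor); the continuation may depend on the signs of the values just
computed, and on nothing else.  The running time is the number of rounds.  For `p = 1` this is the
usual sequential algebraic computation tree. -/

/-- An operand: an input number, or the value computed in round `t` by processor `q`. -/
inductive Cell (p : ℕ) (ι : Type) : Type
  | input (i : ι)
  | computed (t : ℕ) (q : Fin p)

/-- The instructions of a processor; `lt a b` produces `1` if `a < b` and `0` otherwise. -/
inductive Instr (κ : Type) : Type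
  | const (r : ℝ)
  | add (a b : κ)
  | sub (a b : κ)
  | mul (a b : κ)
  | div (a b : κ)
  | lt (a b : κ)

/-- The content of a cell, for input `x` and values `mem` computed so far. -/
def Cell.get {p : ℕ} {ι : Type} (x : ι → ℝ) (mem : ℕ → Fin p → ℝ) : Cell p ι → ℝ
  | .input i => x i
  | .computed t q => mem t q

open Classical in
/-- The value produced by an instruction. -/
noncomputable def Instr.eval {κ : Type} (v : κ → ℝ) : Instr κ → ℝ
  | .const r => r
  | .add a b => v a + v b
  | .sub a b => v a - v b
  | .mul a b => v a * v b
  | .div a b => v a / v b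
  | .lt a b => if v a < v b then 1 else 0

/-- Programs for `p` processors, with inputs indexed by `ι` and outputs indexed by `ω`. -/
inductive Program (p : ℕ) (ι ω : Type) : Type
  | halt (out : ω → Cell p ι)
  | round (ins : Fin p → Instr (Cell p ι)) (next : (Fin p → Bool) → Program p ι ω)

namespace Program

variable {p : ℕ} {ι ω : Type}

open Classical in
/-- Execution on input `x`, after `t` rounds that have produced the values `mem`: the final output
and the total number of rounds. -/
noncomputable def exec (x : ι → ℝ) : Program p ι ω → (ℕ → Fin p → ℝ) → ℕ → (ω → ℝ) × ℕ
  | halt out, mem, t => (fun w => (out w).get x mem, t)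
  | round ins next, mem, t =>
      exec x (next fun q => decide (0 < (ins q).eval (Cell.get x mem)))
        (Function.update mem t fun q => (ins q).eval (Cell.get x mem)) (t + 1)

/-- The output of a program on input `x`. -/
noncomputable def output (P : Program p ι ω) (x : ι → ℝ) : ω → ℝ :=
  (P.exec x (fun _ _ => 0) 0).1

/-- The running time (number of rounds) of a program on input `x`. -/
noncomputable def time (P : Program p ι ω) (x : ι → ℝ) : ℕ :=
  (P.exec x (fun _ _ => 0) 0).2

end Program

/-! ## LP solvers -/

/-- The numbers describing a program with `n` variables and `m` constraints. -/
inductive LPInput (n m : ℕ) : Type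
  | A (i : Fin m) (j : Fin n)
  | b (i : Fin m)
  | c (j : Fin n)

/-- The input numbers given by the data `(A, b, c)`. -/
def LPData.toInput {n m : ℕ} (L : LPData n m) : LPInput n m → ℝ
  | .A i j => L.A i j
  | .b i => L.b i
  | .c j => L.c j

/-- The numbers a solver returns: a primal vector `x` and dual vectors `φ`, `ψ`. -/
inductive LPOutput (n m : ℕ) : Type
  | x (j : Fin n)
  | φ (i : Fin m)
  | ψ (j : Fin n)

/-- An LP solver on `p` processors: a program for every number of variables and constraints. -/
def Solver (p : ℕ) : Type := ∀ n m : ℕ, Program p (LPInput n m) (LPOutput n m)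

namespace Solver

variable {p n m : ℕ}

/-- The primal solution returned by the solver. -/
noncomputable def x (𝒜 : Solver p) (L : LPData n m) (j : Fin n) : ℝ :=
  (𝒜 n m).output L.toInput (.x j)

/-- The row prices returned by the solver. -/
noncomputable def φ (𝒜 : Solver p) (L : LPData n m) (i : Fin m) : ℝ :=
  (𝒜 n m).output L.toInput (.φ i)

/-- The dual variables of the bounds `x_j ≤ 1` returned by the solver. -/
noncomputable def ψ (𝒜 : Solver p) (L : LPData n m) (j : Fin n) : ℝ :=
  (𝒜 n m).output L.toInput (.ψ j)

/-- `𝒜` is an `(αp, αd)`-approximation algorithm for packing linear programs. -/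
def IsApproxAlgorithm (𝒜 : Solver p) (αp αd : ℝ) : Prop :=
  ∀ (n m : ℕ) (L : LPData n m), L.IsPacking → L.ApproxCompSlack αp αd (𝒜.x L) (𝒜.φ L) (𝒜.ψ L)

/-- `𝒜` takes at most `f n m` rounds on packing programs with `n` variables, `m` constraints. -/
def HasRuntime (𝒜 : Solver p) (f : ℕ → ℕ → ℕ) : Prop :=
  ∀ (n m : ℕ) (L : LPData n m), L.IsPacking → (𝒜 n m).time L.toInput ≤ f n m

end Solver

/-! ## The acceleration algorithm -/

/-- The number `s = ⌈n εs⌉` of sampled variables. -/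
noncomputable def sampleSize (n : ℕ) (εs : ℝ) : ℕ := ⌈(n : ℝ) * εs⌉₊

/-- The possible samples: sets of `s` of the `n` variables. -/
abbrev Sample (n s : ℕ) : Type := {S : Finset (Fin n) // S.card = s}

/-- Probability of an event when the sample is drawn uniformly at random. -/
noncomputable def sampleProb {n s : ℕ} (E : Sample n s → Prop) : ℝ :=
  (Nat.card {S : Sample n s // E S} : ℝ) / (Nat.card (Sample n s) : ℝ)

/-- The sample LP: the variables in `S`, relabelled `1, …, s`, with right-hand side
`(1 - ε) εs / αd * b`. -/
noncomputable def sampleLP {n m s : ℕ} (L : LPData n m) (αd εs ε : ℝ) (S : Sample n s) :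
    LPData s m where
  A i k := L.A i (S.1.orderEmbOfFin S.2 k)
  b i := (1 - ε) * εs / αd * L.b i
  c k := L.c (S.1.orderEmbOfFin S.2 k)

open Classical in
/-- The allocation rule `x_j(φ)`. -/
noncomputable def allocation {n m : ℕ} (L : LPData n m) (φ : Fin m → ℝ) (j : Fin n) : ℝ :=
  if ∑ i, L.A i j * φ i < L.c j then 1 else 0

/-- Output of the core acceleration algorithm with feasibility parameter `ε`, for the sample `S`. -/
noncomputable def accelerated {p n m s : ℕ} (𝒜 : Solver p) (αd εs ε : ℝ) (L : LPData n m)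
    (S : Sample n s) : Fin n → ℝ :=
  allocation L (𝒜.φ (sampleLP L αd εs ε S))

/-- The core acceleration algorithm, for programs with `n` variables and `m` constraints, can be
executed on `p` processors in time `τ`: for every sample there is a program (which does not depend
on the input LP) that computes the algorithm's output on every packing LP, and the time for drawing
the sample, `⌈s / p⌉`, plus the number of rounds of the program is at most `τ`. -/
def AcceleratedRunsIn {p : ℕ} (𝒜 : Solver p) (n m : ℕ) (αd εs ε : ℝ) (τ : ℕ) : Prop :=
  ∃ P : Sample n (sampleSize n εs) → Program p (LPInput n m) (Fin n),
    ∀ L : LPData n m, L.IsPacking → ∀ S : Sample n (sampleSize n εs),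
      (P S).output L.toInput = accelerated 𝒜 αd εs ε L S ∧
      sampleSize n εs ⌈/⌉ p + (P S).time L.toInput ≤ τ

/-! The output depends on the sample only through the pattern `T = {j | φᵀ a_j < c_j}`.
Complementary slackness controls the load of `T` inside the sample. A sampled variable of `T` has `ψ
> 0`, hence `x ≥ 1 / αd`, so every row has sampled load at most `(1 - ε) εs b_i` (`sample_load_le`).
A row with `φ_i > 0` has sampled load at least `(1 - ε) εs b_i / αd²`, up to the at most `m` ties
(`le_sample_load`). If full loads are close to `1 / εs` times sampled loads, then `T` is feasible
and fills every priced row to `(1 - 3ε) / αd²` of its capacity. Weak duality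
(`mul_value_le_value_allocation`) turns this into the approximation ratio against every feasible
point of the LP, hence also against every integral one.

Since `T` depends on the sample, concentration is applied to each fixed pattern, followed by a union
bound. Patterns are cut out by halfspaces, so their VC dimension is at most `m` and Sauer–Shelah
leaves at most `(m + 1) n ^ m` of them (`card_halfspace_patterns_le`). For a fixed pattern and row,
Chernoff's bound survives sampling without replacement because the moment generating function is
dominated by that of independent trials (`sum_powersetCard_exp_le`). The lower bound on `εf` makes
each failure probability at most `n ^ (-2(m + 2))`, and the sum at most `1 / n`.

For the running time, the solver is run as a subroutine of a larger computation tree (`exec_bind`),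
and the allocation rule is evaluated in blocks of `2m + 2` rounds, `p` variables per block
(`exec_allocProgram`). -/

/-! ### Concentration for uniformly random subsets of fixed size -/

/-- A random `s`-subset contains a fixed `k`-set with probability `∏_{i<k} (s - i) / (n - i)`, and
each factor is at most `s / n`. -/
theorem Nat.choose_sub_sub_mul_pow_le {n s k : ℕ} (hs : s ≤ n) (hk : k ≤ s) :
    (n - k).choose (s - k) * n ^ k ≤ n.choose s * s ^ k := by
  induction k with
  | zero => simp
  | succ k ih =>
    have ih := ih (by omega)
    obtain ⟨a, rfl⟩ : ∃ a, n = a + k + 1 := ⟨n - k - 1, by omega⟩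
    obtain ⟨t, rfl⟩ : ∃ t, s = t + k + 1 := ⟨s - k - 1, by omega⟩
    have e1 : a + k + 1 - k = a + 1 := by omega
    have e2 : t + k + 1 - k = t + 1 := by omega
    have e3 : a + k + 1 - (k + 1) = a := by omega
    have e4 : t + k + 1 - (k + 1) = t := by omega
    rw [e1, e2] at ih
    rw [e3, e4]
    have h := Nat.add_one_mul_choose_eq a t
    have hle : (t + 1) * (a + k + 1) ≤ (t + k + 1) * (a + 1) := by nlinarith
    refine Nat.le_of_mul_le_mul_left ?_ (by omega : 0 < a + 1)
    calc (a + 1) * (a.choose t * (a + k + 1) ^ (k + 1))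
        = ((a + 1) * a.choose t) * (a + k + 1) ^ k * (a + k + 1) := by ring
      _ = ((a + 1).choose (t + 1) * (a + k + 1) ^ k) * ((t + 1) * (a + k + 1)) := by
          rw [h]; ring
      _ ≤ ((a + k + 1).choose (t + k + 1) * (t + k + 1) ^ k) * ((t + k + 1) * (a + 1)) :=
          Nat.mul_le_mul ih hle
      _ = _ := by ring

namespace Finset

variable {ι : Type*} [Fintype ι] [DecidableEq ι]

/-- Products over a uniformly random `s`-subset are dominated in the mean by products of
independent Bernoulli trials: the case of factors at least `1`. -/
theorem sum_powersetCard_prod_one_add_le {s : ℕ} (hs : s ≤ Fintype.card ι) {t : ι → ℝ}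
    (ht : ∀ j, 0 ≤ t j) :
    ∑ S ∈ powersetCard s (univ : Finset ι), ∏ j ∈ S, (1 + t j) ≤
      (Fintype.card ι).choose s * ∏ j, (1 + (s / Fintype.card ι : ℝ) * t j) := by
  -- Expand over `T ⊆ S` and swap the sums: the coefficient of `∏_T t` counts the samples containing
  -- `T`. As `t ≥ 0`, coefficients can then be compared one by one.
  have h1 : ∑ S ∈ powersetCard s (univ : Finset ι), ∏ j ∈ S, (1 + t j) =
      ∑ T : Finset ι, (#{S ∈ powersetCard s (univ : Finset ι) | T ⊆ S} : ℝ) * ∏ j ∈ T, t j := by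
    simp_rw [prod_one_add, card_filter, Nat.cast_sum, sum_mul]
    rw [sum_comm]
    refine sum_congr rfl fun S _ => ?_
    rw [← sum_subset (subset_univ S.powerset)]
    · refine sum_congr rfl fun T hT => ?_
      simp [mem_powerset.1 hT]
    · intro T _ hT
      simp [mt mem_powerset.2 hT]
  rw [h1, prod_one_add, mul_sum, powerset_univ]
  refine sum_le_sum fun T _ => ?_
  rw [prod_mul_distrib, prod_const, ← mul_assoc]
  refine mul_le_mul_of_nonneg_right ?_ (prod_nonneg fun j _ => ht j)
  by_cases hT : #T ≤ s
  · rw [card_filter_powersetCard_subset _ _ _ (subset_univ T) hT, card_univ, div_pow, ← mul_div_assoc]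
    rcases Nat.eq_zero_or_pos #T with h0 | hpos
    · simp [h0]
    · have hn : 0 < Fintype.card ι := by omega
      rw [le_div_iff₀ (by positivity)]
      exact_mod_cast Nat.choose_sub_sub_mul_pow_le hs hT
  · rw [filter_false_of_mem]
    · simp only [card_empty, Nat.cast_zero]; positivity
    · intro S hS hTS
      exact hT ((card_le_card hTS).trans_eq (mem_powersetCard.1 hS).2)

/-- The case of factors at most `1`. -/
theorem sum_powersetCard_prod_le_of_le_one {s : ℕ} (hs : s ≤ Fintype.card ι)
    (hn : 0 < Fintype.card ι) {u : ι → ℝ} (hu : ∀ j, 0 < u j) (hu1 : ∀ j, u j ≤ 1) :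
    ∑ S ∈ powersetCard s (univ : Finset ι), ∏ j ∈ S, u j ≤
      (Fintype.card ι).choose s * ∏ j, (1 + (s / Fintype.card ι : ℝ) * (u j - 1)) := by
  -- Passing to complements inverts the factors: `∏_S u` is `∏ u` times the product of `u⁻¹ ≥ 1`
  -- over the random `(n - s)`-subset `Sᶜ`.
  have h1 : ∑ S ∈ powersetCard s (univ : Finset ι), ∏ j ∈ S, u j =
      (∏ j, u j) * ∑ S ∈ powersetCard (Fintype.card ι - s) (univ : Finset ι),
        ∏ j ∈ S, (1 + ((u j)⁻¹ - 1)) := by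
    rw [mul_sum]
    refine sum_bij' (fun S _ => Sᶜ) (fun S _ => Sᶜ) ?_ ?_ ?_ ?_ ?_
    · intro S hS
      simp only [mem_powersetCard, subset_univ, true_and] at hS ⊢
      rw [card_compl, hS]
    · intro S hS
      simp only [mem_powersetCard, subset_univ, true_and] at hS ⊢
      rw [card_compl, hS]; omega
    · simp
    · simp
    · intro S _
      rw [← prod_mul_prod_compl S u, mul_assoc, ← prod_mul_distrib]
      have h2 : ∏ j ∈ Sᶜ, u j * (1 + ((u j)⁻¹ - 1)) = 1 := prod_eq_one fun j _ => by
        rw [add_sub_cancel, mul_inv_cancel₀ (hu j).ne']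
      rw [h2, mul_one]
  rw [h1]
  refine (mul_le_mul_of_nonneg_left (sum_powersetCard_prod_one_add_le (Nat.sub_le _ _)
    fun j => ?_) (prod_nonneg fun j _ => (hu j).le)).trans_eq ?_
  · rw [sub_nonneg]; exact (one_le_inv₀ (hu j)).2 (hu1 j)
  · rw [Nat.choose_symm hs, mul_left_comm, ← prod_mul_distrib]
    congr 1
    refine prod_congr rfl fun j _ => ?_
    rw [Nat.cast_sub hs]
    have := hu j
    field_simp
    ring

/-- Moment generating function of the sum of weights in `[0, 1]` over a random `s`-subset. -/
theorem sum_powersetCard_exp_le {s : ℕ} (hs : s ≤ Fintype.card ι)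
    (hn : 0 < Fintype.card ι) {w : ι → ℝ} (hw : ∀ j, 0 ≤ w j) (hw1 : ∀ j, w j ≤ 1) (l : ℝ) :
    ∑ S ∈ powersetCard s (univ : Finset ι), Real.exp (l * ∑ j ∈ S, w j) ≤
      (Fintype.card ι).choose s *
        Real.exp ((s / Fintype.card ι : ℝ) * (∑ j, w j) * (Real.exp l - 1)) := by
  have hprod : ∑ S ∈ powersetCard s (univ : Finset ι), Real.exp (l * ∑ j ∈ S, w j) =
      ∑ S ∈ powersetCard s (univ : Finset ι), ∏ j ∈ S, Real.exp (l * w j) := by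
    simp_rw [mul_sum, Real.exp_sum]
  have hmain : ∑ S ∈ powersetCard s (univ : Finset ι), ∏ j ∈ S, Real.exp (l * w j) ≤
      (Fintype.card ι).choose s *
        ∏ j, (1 + (s / Fintype.card ι : ℝ) * (Real.exp (l * w j) - 1)) := by
    rcases le_total 0 l with hl | hl
    · have := sum_powersetCard_prod_one_add_le hs (t := fun j => Real.exp (l * w j) - 1)
        fun j => by
          have := Real.one_le_exp (mul_nonneg hl (hw j)); linarith
      simpa using this
    · exact sum_powersetCard_prod_le_of_le_one hs hn (fun j => Real.exp_pos _)
        fun j => Real.exp_le_one_iff.2 (mul_nonpos_of_nonpos_of_nonneg hl (hw j))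
  rw [hprod]
  refine hmain.trans (mul_le_mul_of_nonneg_left ?_ (Nat.cast_nonneg _))
  rw [mul_sum, sum_mul, Real.exp_sum]
  have hsn : (s / Fintype.card ι : ℝ) ≤ 1 :=
    div_le_one_of_le₀ (by exact_mod_cast hs) (Nat.cast_nonneg _)
  have hsn0 : (0 : ℝ) ≤ s / Fintype.card ι := by positivity
  refine prod_le_prod (fun j _ => ?_) fun j _ => ?_
  · nlinarith [Real.exp_pos (l * w j)]
  · have hconv : Real.exp (l * w j) - 1 ≤ w j * (Real.exp l - 1) := by
      have := convexOn_exp.2 (Set.mem_univ 0) (Set.mem_univ l) (sub_nonneg.2 (hw1 j)) (hw j)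
        (by ring)
      simp only [smul_eq_mul, mul_zero, zero_add, Real.exp_zero, mul_one] at this
      rw [mul_comm l]
      linarith
    calc 1 + (s / Fintype.card ι : ℝ) * (Real.exp (l * w j) - 1)
        ≤ (s / Fintype.card ι : ℝ) * w j * (Real.exp l - 1) + 1 := by
          nlinarith [mul_le_mul_of_nonneg_left hconv hsn0]
      _ ≤ _ := Real.add_one_le_exp _

/-- Chernoff's inequality for the sum of weights in `[0, 1]` over a random `s`-subset. -/
theorem card_filter_powersetCard_le_exp {s : ℕ} (hs : s ≤ Fintype.card ι)
    (hn : 0 < Fintype.card ι) {w : ι → ℝ} (hw : ∀ j, 0 ≤ w j) (hw1 : ∀ j, w j ≤ 1) (l θ : ℝ) :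
    (#{S ∈ powersetCard s (univ : Finset ι) | l * θ ≤ l * ∑ j ∈ S, w j} : ℝ) ≤
      (Fintype.card ι).choose s *
        Real.exp ((s / Fintype.card ι : ℝ) * (∑ j, w j) * (Real.exp l - 1) - l * θ) := by
  rw [sub_eq_add_neg, Real.exp_add, ← mul_assoc, Real.exp_neg, ← div_eq_mul_inv,
    le_div_iff₀ (Real.exp_pos _)]
  refine le_trans ?_ (sum_powersetCard_exp_le hs hn hw hw1 l)
  rw [← nsmul_eq_mul, ← sum_const]
  refine (sum_le_sum fun S hS => ?_).trans
    (sum_le_sum_of_subset_of_nonneg (filter_subset _ _) fun S _ _ => (Real.exp_pos _).le)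
  exact Real.exp_le_exp.2 (mem_filter.1 hS).2

/-- Lower tail. -/
theorem card_filter_powersetCard_lower_tail {s : ℕ} (hs : s ≤ Fintype.card ι)
    (hn : 0 < Fintype.card ι) {w : ι → ℝ} (hw : ∀ j, 0 ≤ w j) (hw1 : ∀ j, w j ≤ 1)
    {ε K : ℝ} (hε : 0 ≤ ε) (hε1 : ε ≤ 1) (hK : K ≤ (s / Fintype.card ι : ℝ) * ∑ j, w j) :
    (#{S ∈ powersetCard s (univ : Finset ι) | ∑ j ∈ S, w j ≤ (1 - ε) * K} : ℝ) ≤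
      (Fintype.card ι).choose s * Real.exp (-(ε ^ 2 * K / 2)) := by
  have h := card_filter_powersetCard_le_exp hs hn hw hw1 (-ε) ((1 - ε) * K)
  refine le_trans (Nat.cast_le.2 (card_le_card ?_)) (h.trans ?_)
  · intro S hS
    rw [mem_filter] at hS ⊢
    exact ⟨hS.1, by nlinarith [hS.2]⟩
  · refine mul_le_mul_of_nonneg_left (Real.exp_le_exp.2 ?_) (Nat.cast_nonneg _)
    -- Bound `exp ε` below by its quadratic Taylor polynomial and invert; `(1 + ε²/2)² - ε² = 1 +
    -- ε⁴/4 ≥ 1`.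
    have h1 : Real.exp (-ε) - 1 ≤ -ε + ε ^ 2 / 2 := by
      have h2 := Real.quadratic_le_exp_of_nonneg hε
      rw [Real.exp_neg, sub_le_iff_le_add]
      refine (inv_anti₀ (by positivity) h2).trans ?_
      rw [inv_le_iff_one_le_mul₀ (by positivity)]
      nlinarith [sq_nonneg (ε ^ 2)]
    have h3 : Real.exp (-ε) - 1 ≤ 0 := by
      rw [sub_nonpos]; exact Real.exp_le_one_iff.2 (by linarith)
    have hμ : 0 ≤ (s / Fintype.card ι : ℝ) * ∑ j, w j :=
      mul_nonneg (by positivity) (sum_nonneg fun j _ => hw j)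
    nlinarith [mul_le_mul_of_nonneg_left h1 hμ,
      mul_nonneg (sub_nonneg.2 hK) (by nlinarith : 0 ≤ ε - ε ^ 2 / 2)]

/-- Upper tail. -/
theorem card_filter_powersetCard_upper_tail {s : ℕ} (hs : s ≤ Fintype.card ι)
    (hn : 0 < Fintype.card ι) {w : ι → ℝ} (hw : ∀ j, 0 ≤ w j) (hw1 : ∀ j, w j ≤ 1)
    {ε K : ℝ} (hε : 0 ≤ ε) (hε1 : ε ≤ 1) (hK0 : 0 ≤ K)
    (hK : (s / Fintype.card ι : ℝ) * ∑ j, w j ≤ (1 - 3 * ε) * K) :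
    (#{S ∈ powersetCard s (univ : Finset ι) | (1 - 2 * ε) * K ≤ ∑ j ∈ S, w j} : ℝ) ≤
      (Fintype.card ι).choose s * Real.exp (-(ε ^ 2 * K / 2)) := by
  have h := card_filter_powersetCard_le_exp hs hn hw hw1 ε ((1 - 2 * ε) * K)
  refine le_trans (Nat.cast_le.2 (card_le_card ?_)) (h.trans ?_)
  · intro S hS
    rw [mem_filter] at hS ⊢
    exact ⟨hS.1, mul_le_mul_of_nonneg_left hS.2 hε⟩
  · refine mul_le_mul_of_nonneg_left (Real.exp_le_exp.2 ?_) (Nat.cast_nonneg _)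
    have h1 : Real.exp ε - 1 ≤ ε + ε ^ 2 / 2 + ε ^ 3 / 3 := by
      have := Real.exp_bound' hε hε1 (n := 3) (by norm_num)
      simp [sum_range_succ, Nat.factorial] at this
      nlinarith [pow_nonneg hε 3]
    have h3 : 0 ≤ Real.exp ε - 1 := by
      have := Real.one_le_exp hε; linarith
    have hμ : 0 ≤ (s / Fintype.card ι : ℝ) * ∑ j, w j :=
      mul_nonneg (by positivity) (sum_nonneg fun j _ => hw j)
    have h4 := mul_le_mul_of_nonneg_right hK h3
    have h5 := mul_le_mul_of_nonneg_left h1 (hμ.trans hK)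
    -- The gap between `1 - 3ε` and `1 - 2ε` contributes `-ε² K`, which outweighs the second-order
    -- term `ε² K / 2` of the exponential.
    have h6 : (1 - 3 * ε) * K * (ε + ε ^ 2 / 2 + ε ^ 3 / 3) - ε * ((1 - 2 * ε) * K) =
        -(ε ^ 2 * K / 2) - K * ε ^ 3 * (7 / 6 + ε) := by ring
    have h7 : 0 ≤ K * ε ^ 3 * (7 / 6 + ε) := by positivity
    linarith

end Finset

/-! ### Counting the patterns of the allocation rule -/

open Finset in
/-- Affine halfspaces of `ℝ^m` cut out at most `(m + 1) n ^ m` subsets of `n` given points. -/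
theorem card_halfspace_patterns_le {n m : ℕ} (hn : 1 ≤ n) (a : Fin m → Fin n → ℝ) (c : Fin n → ℝ)
    (F : Finset (Finset (Fin n)))
    (hF : ∀ T ∈ F, ∃ φ : Fin m → ℝ, ∀ j, j ∈ T ↔ ∑ i, a i j * φ i < c j) :
    #F ≤ (m + 1) * n ^ m := by
  have hvc : F.vcDim ≤ m := by
    rw [Finset.vcDim, Finset.sup_le_iff]
    intro U hU
    rw [mem_shatterer] at hU
    by_contra! hcard
    have hli : ¬ LinearIndependent ℝ (fun j : U => fun i => a i j) := by
      intro h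
      have := h.fintype_card_le_finrank
      simp at this
      omega
    rw [Fintype.not_linearIndependent_iff] at hli
    obtain ⟨g, hg, j₀, hj₀⟩ := hli
    have hg' : ∀ i, ∑ j : U, g j * a i j = 0 := fun i => by
      have := congrFun hg i
      simpa using this
    -- A linear dependence `g` among more than `m` columns makes this sum independent of `φ`.
    -- Shattering realizes both patterns `g < 0` and `0 < g`; the first makes every term
    -- nonnegative, the second nonpositive, and the term at `j₀` is nonzero in one of them.
    have key : ∀ φ : Fin m → ℝ, ∑ j : U, g j * (∑ i, a i j * φ i - c j) = -∑ j : U, g j * c j := by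
      intro φ
      simp_rw [mul_sub, sum_sub_distrib, mul_sum]
      rw [sum_comm]
      have : ∀ i, ∑ j : U, g j * (a i j * φ i) = 0 := fun i => by
        rw [← zero_mul (φ i), ← hg' i, sum_mul]
        exact sum_congr rfl fun j _ => by ring
      rw [sum_eq_zero fun i _ => this i, zero_sub]
    have pat : ∀ Q : U → Prop, ∃ φ : Fin m → ℝ, ∀ j : U, Q j ↔ ∑ i, a i j * φ i < c j := by
      classical
      intro Q
      have hsub : (univ.filter Q).map (Function.Embedding.subtype _) ⊆ U := by
        intro j hj
        simp only [mem_map, Function.Embedding.subtype_apply] at hj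
        obtain ⟨y, _, rfl⟩ := hj
        exact y.2
      obtain ⟨T, hT, hUT⟩ := hU hsub
      obtain ⟨φ, hφ⟩ := hF T hT
      refine ⟨φ, fun j => ?_⟩
      rw [← hφ]
      have := Finset.ext_iff.1 hUT j
      simpa using this.symm
    obtain ⟨φ, hφ⟩ := pat fun j => g j < 0
    obtain ⟨χ, hχ⟩ := pat fun j => 0 < g j
    have h1 : ∀ j : U, 0 ≤ g j * (∑ i, a i j * φ i - c j) := fun j => by
      rcases lt_or_ge (g j) 0 with h | h
      · exact mul_nonneg_of_nonpos_of_nonpos h.le (sub_nonpos.2 ((hφ j).1 h).le)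
      · exact mul_nonneg h (sub_nonneg.2 (not_lt.1 fun h' => not_lt.2 h ((hφ j).2 h')))
    have h2 : ∀ j : U, g j * (∑ i, a i j * χ i - c j) ≤ 0 := fun j => by
      rcases le_or_gt (g j) 0 with h | h
      · exact mul_nonpos_of_nonpos_of_nonneg h
          (sub_nonneg.2 (not_lt.1 fun h' => not_lt.2 h ((hχ j).2 h')))
      · exact mul_nonpos_of_nonneg_of_nonpos h.le (sub_nonpos.2 ((hχ j).1 h).le)
    have e1 := sum_nonneg fun j (_ : j ∈ univ) => h1 j
    have e2 := sum_nonpos fun j (_ : j ∈ univ) => h2 j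
    rcases lt_or_gt_of_ne hj₀ with h | h
    · have := sum_pos' (fun j (_ : j ∈ univ) => h1 j)
        ⟨j₀, mem_univ _, mul_pos_of_neg_of_neg h (sub_neg.2 ((hφ j₀).1 h))⟩
      rw [key] at this e2
      linarith
    · have := sum_neg' (fun j (_ : j ∈ univ) => h2 j)
        ⟨j₀, mem_univ _, mul_neg_of_pos_of_neg h (sub_neg.2 ((hχ j₀).1 h))⟩
      rw [key] at this e1
      linarith
  calc #F ≤ #F.shatterer := card_le_card_shatterer F
    _ ≤ ∑ k ∈ Iic F.vcDim, (Fintype.card (Fin n)).choose k := card_shatterer_le_sum_vcDim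
    _ ≤ ∑ k ∈ Iic m, (Fintype.card (Fin n)).choose k :=
        sum_le_sum_of_subset (Iic_subset_Iic.2 hvc)
    _ ≤ ∑ _k ∈ Iic m, n ^ m := by
        refine sum_le_sum fun k hk => ?_
        rw [Fintype.card_fin]
        exact (Nat.choose_le_pow n k).trans (Nat.pow_le_pow_right hn (mem_Iic.1 hk))
    _ = (m + 1) * n ^ m := by simp

/-! ### Deterministic analysis of the allocation rule -/

section Allocation

variable {n m : ℕ}

theorem allocation_eq_zero_or_one (L : LPData n m) (φ : Fin m → ℝ) (j : Fin n) :
    allocation L φ j = 0 ∨ allocation L φ j = 1 := by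
  unfold allocation
  split_ifs <;> simp

theorem allocation_nonneg (L : LPData n m) (φ : Fin m → ℝ) (j : Fin n) :
    0 ≤ allocation L φ j := by
  rcases allocation_eq_zero_or_one L φ j with h | h <;> simp [h]

theorem allocation_le_one (L : LPData n m) (φ : Fin m → ℝ) (j : Fin n) :
    allocation L φ j ≤ 1 := by
  rcases allocation_eq_zero_or_one L φ j with h | h <;> simp [h]

theorem sum_orderEmbOfFin {s : ℕ} (S : Sample n s) (g : Fin n → ℝ) :
    ∑ k, g (S.1.orderEmbOfFin S.2 k) = ∑ j ∈ S.1, g j := by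
  conv_rhs => rw [← Finset.map_orderEmbOfFin_univ S.1 S.2, Finset.sum_map]
  rfl

theorem LPData.IsPacking.sampleLP {s : ℕ} {L : LPData n m} (hL : L.IsPacking) {αd εs ε : ℝ}
    (hα : 0 ≤ αd) (hεs : 0 ≤ εs) (hε : ε ≤ 1) (S : Sample n s) :
    (sampleLP L αd εs ε S).IsPacking where
  A_nonneg _ _ := hL.A_nonneg _ _
  A_le_one _ _ := hL.A_le_one _ _
  b_nonneg i := mul_nonneg (div_nonneg (mul_nonneg (sub_nonneg.2 hε) hεs) hα) (hL.b_nonneg i)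
  c_nonneg _ := hL.c_nonneg _

/-- Selected variables of the sample LP are at least `1 / αd`, so that their total weight exceeds
the load of the sample LP at most by the factor `αd`. -/
theorem sample_load_le {s : ℕ} {L : LPData n m} (hL : L.IsPacking) {αd εs ε : ℝ} (hα : 1 ≤ αd)
    (S : Sample n s) {x : Fin s → ℝ} {φ : Fin m → ℝ} {ψ : Fin s → ℝ}
    (h : (sampleLP L αd εs ε S).ApproxCompSlack 1 αd x φ ψ) (i : Fin m) :
    ∑ j ∈ S.1, L.A i j * allocation L φ j ≤ (1 - ε) * (εs * L.b i) := by
  rw [← sum_orderEmbOfFin S fun j => L.A i j * allocation L φ j]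
  have hx : ∀ k, allocation L φ (S.1.orderEmbOfFin S.2 k) ≤ αd * x k := by
    intro k
    have hx0 := (h.primal_feasible.2 k).1
    unfold allocation
    split_ifs with hk
    · have hψ : 0 < ψ k := by
        have := h.dual_feasible.2.2 k
        simp only [sampleLP] at this
        linarith
      have := (h.dual_slack_bound k hψ).1
      rw [div_le_iff₀ (by linarith)] at this
      linarith
    · positivity
  have hrow := h.primal_feasible.1 i
  simp only [sampleLP] at hrow
  calc ∑ k, L.A i (S.1.orderEmbOfFin S.2 k) * allocation L φ (S.1.orderEmbOfFin S.2 k)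
      ≤ ∑ k, αd * (L.A i (S.1.orderEmbOfFin S.2 k) * x k) :=
        Finset.sum_le_sum fun k _ => by
          nlinarith [mul_le_mul_of_nonneg_left (hx k) (hL.A_nonneg i (S.1.orderEmbOfFin S.2 k))]
    _ ≤ αd * ((1 - ε) * εs / αd * L.b i) := by
        rw [← Finset.mul_sum]
        exact mul_le_mul_of_nonneg_left hrow (by linarith)
    _ = (1 - ε) * (εs * L.b i) := by
        have : αd ≠ 0 := by linarith
        field_simp

/-- Rows with a positive price carry a large load in the sample: the allocation rule misses only
the at most `m` columns whose price is tight. -/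
theorem le_sample_load {s : ℕ} {L : LPData n m} (hL : L.IsPacking) (hG : L.GeneralPosition)
    {αd εs ε : ℝ} (S : Sample n s) {x : Fin s → ℝ} {φ : Fin m → ℝ} {ψ : Fin s → ℝ}
    (h : (sampleLP L αd εs ε S).ApproxCompSlack 1 αd x φ ψ) {i : Fin m} (hi : 0 < φ i) :
    (1 - ε) * (εs * L.b i / αd ^ 2) - m ≤ ∑ j ∈ S.1, L.A i j * allocation L φ j := by
  classical
  set tie : Fin n → ℝ := fun j => if ∑ i, L.A i j * φ i = L.c j then 1 else 0 with htie
  have htie_sum : ∑ j ∈ S.1, tie j ≤ m := by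
    have h1 := hG φ h.dual_feasible.1
    rw [Nat.card_eq_fintype_card, Fintype.card_subtype] at h1
    calc ∑ j ∈ S.1, tie j ≤ ∑ j, tie j :=
          Finset.sum_le_sum_of_subset_of_nonneg (Finset.subset_univ _)
            fun j _ _ => by simp only [htie]; split_ifs <;> norm_num
      _ ≤ m := by
          simp only [htie, Finset.sum_boole]
          exact_mod_cast h1
  have hx : ∀ k, x k ≤ allocation L φ (S.1.orderEmbOfFin S.2 k) + tie (S.1.orderEmbOfFin S.2 k) := by
    intro k
    obtain ⟨hx0, hx1⟩ := h.primal_feasible.2 k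
    have hψ := h.dual_feasible.2.1 k
    rcases hx0.eq_or_lt with h0 | hpos
    · rw [← h0]
      refine add_nonneg (allocation_nonneg L φ _) ?_
      simp only [htie]; split_ifs <;> norm_num
    · have hs := (h.primal_slack k hpos).2
      simp only [sampleLP, one_mul] at hs
      rcases (show ∑ i, L.A i (S.1.orderEmbOfFin S.2 k) * φ i ≤ L.c (S.1.orderEmbOfFin S.2 k) by
        linarith).eq_or_lt with he | hlt
      · have := allocation_nonneg L φ (S.1.orderEmbOfFin S.2 k)
        simp only [htie, if_pos he]
        linarith
      · simp only [htie, if_neg hlt.ne, allocation, if_pos hlt]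
        linarith
  have hrow := (h.dual_slack_row i hi).1
  simp only [sampleLP] at hrow
  -- One factor `αd` comes from the scaled right-hand side of the sample LP, the other from dual
  -- slackness.
  have hb : (1 - ε) * εs / αd * L.b i / αd = (1 - ε) * (εs * L.b i / αd ^ 2) := by
    ring
  rw [hb] at hrow
  have h2 : ∑ k, L.A i (S.1.orderEmbOfFin S.2 k) * x k ≤
      ∑ k, (L.A i (S.1.orderEmbOfFin S.2 k) * allocation L φ (S.1.orderEmbOfFin S.2 k) +
        tie (S.1.orderEmbOfFin S.2 k)) := by
    refine Finset.sum_le_sum fun k _ => ?_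
    have hA0 := hL.A_nonneg i (S.1.orderEmbOfFin S.2 k)
    have hA1 := hL.A_le_one i (S.1.orderEmbOfFin S.2 k)
    have ht : 0 ≤ tie (S.1.orderEmbOfFin S.2 k) := by
      simp only [htie]; split_ifs <;> norm_num
    nlinarith [mul_le_mul_of_nonneg_left (hx k) hA0, mul_le_mul_of_nonneg_right hA1 ht]
  rw [sum_orderEmbOfFin S fun j => L.A i j * allocation L φ j + tie j,
    Finset.sum_add_distrib] at h2
  linarith

/-- Weak duality for the dual solution given by `φ` and the induced prices of the bounds. -/
theorem mul_value_le_value_allocation {L : LPData n m} (φ : Fin m → ℝ) (hφ : ∀ i, 0 ≤ φ i)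
    {β : ℝ} (hβ0 : 0 ≤ β) (hβ1 : β ≤ 1)
    (hrow : ∀ i, 0 < φ i → β * L.b i ≤ ∑ j, L.A i j * allocation L φ j)
    {y : Fin n → ℝ} (hy : y ∈ L.feasible) :
    β * L.value y ≤ L.value (allocation L φ) := by
  -- Priced loads plus reduced costs. The allocation selects exactly the positive reduced costs, so
  -- it maximizes the second sum over the unit cube; the first sum is compared row by row.
  have hsplit : ∀ z : Fin n → ℝ, L.value z =
      ∑ i, φ i * ∑ j, L.A i j * z j + ∑ j, (L.c j - ∑ i, L.A i j * φ i) * z j := by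
    intro z
    unfold LPData.value
    simp_rw [Finset.mul_sum]
    rw [Finset.sum_comm, ← Finset.sum_add_distrib]
    refine Finset.sum_congr rfl fun j _ => ?_
    rw [sub_mul, Finset.sum_mul]
    rw [Finset.sum_congr rfl fun i _ => show φ i * (L.A i j * z j) = L.A i j * φ i * z j by ring]
    ring
  rw [hsplit y, hsplit (allocation L φ), mul_add, Finset.mul_sum, Finset.mul_sum]
  refine add_le_add (Finset.sum_le_sum fun i _ => ?_) (Finset.sum_le_sum fun j _ => ?_)
  · rcases (hφ i).eq_or_lt with h0 | hpos
    · simp [← h0]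
    · rw [mul_left_comm]
      exact mul_le_mul_of_nonneg_left
        ((mul_le_mul_of_nonneg_left (hy.1 i) hβ0).trans (hrow i hpos)) hpos.le
  · obtain ⟨hy0, hy1⟩ := hy.2 j
    unfold allocation
    split_ifs with h
    · have hβy : β * y j ≤ 1 := by nlinarith
      nlinarith [mul_le_mul_of_nonneg_left hβy (sub_nonneg.2 h.le)]
    · rw [mul_zero]
      exact mul_nonpos_of_nonneg_of_nonpos hβ0
        (mul_nonpos_of_nonpos_of_nonneg (by linarith) hy0)

theorem LPData.continuous_value (L : LPData n m) : Continuous L.value := by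
  unfold LPData.value
  fun_prop

theorem LPData.isCompact_feasible (L : LPData n m) : IsCompact L.feasible := by
  have hsub : L.feasible ⊆ Set.Icc (0 : Fin n → ℝ) 1 := fun x hx =>
    ⟨fun j => (hx.2 j).1, fun j => (hx.2 j).2⟩
  refine isCompact_Icc.of_isClosed_subset ?_ hsub
  have hset : L.feasible = (⋂ i, {x | ∑ j, L.A i j * x j ≤ L.b i}) ∩
      ⋂ j, {x : Fin n → ℝ | 0 ≤ x j ∧ x j ≤ 1} := by
    ext x
    simp [LPData.feasible]
  rw [hset]
  refine (isClosed_iInter fun i => isClosed_le (by fun_prop) (by fun_prop)).inter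
    (isClosed_iInter fun j => isClosed_Icc.preimage (continuous_apply j))

theorem LPData.isCompact_intFeasible (L : LPData n m) : IsCompact L.intFeasible := by
  have hset : L.intFeasible = L.feasible ∩ ⋂ j, {x : Fin n → ℝ | x j = 0 ∨ x j = 1} := by
    ext x
    simp [LPData.intFeasible]
  rw [hset]
  refine L.isCompact_feasible.inter_right (isClosed_iInter fun j => ?_)
  exact (isClosed_eq (by fun_prop) (by fun_prop)).union (isClosed_eq (by fun_prop) (by fun_prop))

/-- Compactness supplies the attained optimum that `IsApproxOver` asks for, so comparison with each
point suffices. -/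
theorem LPData.isApproxOver_of_forall {L : LPData n m} {F : Set (Fin n → ℝ)} (hF : IsCompact F)
    {ρ : ℝ} {x : Fin n → ℝ} (hx : x ∈ F) (h : ∀ y ∈ F, ρ * L.value y ≤ L.value x) :
    L.IsApproxOver F ρ x := by
  obtain ⟨y, hy, hmax⟩ := hF.exists_isMaxOn ⟨x, hx⟩ L.continuous_value.continuousOn
  refine ⟨hx, L.value y, ⟨⟨y, hy, rfl⟩, ?_⟩, h y hy⟩
  rintro _ ⟨z, hz, rfl⟩
  exact hmax hz

theorem LPData.value_nonneg {L : LPData n m} (hL : L.IsPacking) {x : Fin n → ℝ}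
    (hx : x ∈ L.feasible) : 0 ≤ L.value x :=
  Finset.sum_nonneg fun j _ => mul_nonneg (hL.c_nonneg j) (hx.2 j).1

/-- The allocation is feasible and nearly optimal when no row is overloaded and no row with a
positive price is underloaded. -/
theorem allocation_isApproxOver {L : LPData n m} (hL : L.IsPacking) (φ : Fin m → ℝ)
    (hφ : ∀ i, 0 ≤ φ i) {β : ℝ} (hβ1 : β ≤ 1)
    (hfeas : ∀ i, ∑ j, L.A i j * allocation L φ j ≤ L.b i)
    (hrow : 0 ≤ β → ∀ i, 0 < φ i → β * L.b i ≤ ∑ j, L.A i j * allocation L φ j) :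
    L.IsApproxOver L.intFeasible β (allocation L φ) ∧
      L.IsApproxOver L.feasible β (allocation L φ) := by
  have hf : allocation L φ ∈ L.feasible :=
    ⟨hfeas, fun j => ⟨allocation_nonneg L φ j, allocation_le_one L φ j⟩⟩
  have hval : ∀ y ∈ L.feasible, β * L.value y ≤ L.value (allocation L φ) := by
    intro y hy
    -- `β` may be negative, since `ε > 1/3` is allowed; the claim is then trivial because values are
    -- nonnegative.
    rcases le_total 0 β with hβ | hβ
    · exact mul_value_le_value_allocation φ hφ hβ hβ1 (hrow hβ) hy
    · exact (mul_nonpos_of_nonpos_of_nonneg hβ (LPData.value_nonneg hL hy)).trans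
        (LPData.value_nonneg hL hf)
  exact ⟨LPData.isApproxOver_of_forall L.isCompact_intFeasible
      ⟨hf, allocation_eq_zero_or_one L φ⟩ fun y hy => hval y hy.1,
    LPData.isApproxOver_of_forall L.isCompact_feasible hf hval⟩

end Allocation

/-! ### Probability of success over the random sample -/

theorem sampleSize_eq {n : ℕ} {εs : ℝ} (h : ∃ k : ℕ, εs * n = k) :
    (sampleSize n εs : ℝ) = εs * n := by
  obtain ⟨k, hk⟩ := h
  rw [sampleSize, mul_comm, hk, Nat.ceil_natCast]

theorem sampleSize_le {n : ℕ} {εs : ℝ} (h1 : εs ≤ 1) : sampleSize n εs ≤ n :=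
  Nat.ceil_le.2 (mul_le_of_le_one_right (Nat.cast_nonneg n) h1)

theorem card_sample (n s : ℕ) : Nat.card (Sample n s) = n.choose s := by
  rw [Nat.card_eq_fintype_card, Fintype.card_finset_len, Fintype.card_fin]

open Finset in
/-- An event containing all samples outside a set of at most `δ * C(n, s)` samples has
probability at least `1 - δ`. -/
theorem one_sub_le_sampleProb {n s : ℕ} (hs : s ≤ n) {E : Sample n s → Prop} {δ : ℝ}
    (bad : Finset (Finset (Fin n))) (hbad : ∀ S : Sample n s, S.1 ∉ bad → E S)
    (hcard : (#bad : ℝ) ≤ δ * n.choose s) : 1 - δ ≤ sampleProb E := by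
  classical
  have hpos : (0 : ℝ) < n.choose s := by exact_mod_cast Nat.choose_pos hs
  rw [sampleProb, card_sample, le_div_iff₀ hpos]
  have h1 : Nat.card {S : Sample n s // ¬ E S} ≤ #bad := by
    rw [Nat.card_eq_fintype_card, ← Fintype.card_coe bad]
    refine Fintype.card_le_of_injective
      (fun S => (⟨S.1.1, by_contra fun h => S.2 (hbad S.1 h)⟩ : bad)) fun S T h => ?_
    exact Subtype.ext (Subtype.ext (Subtype.mk.inj h))
  have h2 : Nat.card {S : Sample n s // E S} + Nat.card {S : Sample n s // ¬ E S} =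
      n.choose s := by
    rw [← card_sample n s]
    simp only [Nat.card_eq_fintype_card]
    rw [Fintype.card_subtype_compl]
    have := Fintype.card_subtype_le E
    omega
  have h1' : (Nat.card {S : Sample n s // ¬ E S} : ℝ) ≤ #bad := by exact_mod_cast h1
  have h2' : (Nat.card {S : Sample n s // E S} : ℝ) + Nat.card {S : Sample n s // ¬ E S} =
      n.choose s := by exact_mod_cast h2
  linarith

/-- Lets the polynomial factor in `m` of the union bound be absorbed into a power of `n ≥ 2`. -/
theorem mul_succ_le_two_pow (m : ℕ) : m * (m + 1) ≤ 2 ^ (m + 2) := by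
  induction m with
  | zero => simp
  | succ k ih =>
    rcases Nat.lt_or_ge k 2 with h | h
    · interval_cases k <;> norm_num
    · rw [show k + 1 + 2 = k + 2 + 1 by ring, pow_succ]
      nlinarith

/-- The union bound over `(m + 1) n ^ m` patterns and `m` rows. -/
theorem union_bound_le {n m : ℕ} (hn : 2 ≤ n) :
    (((m + 1) * n ^ m : ℕ) : ℝ) * (m * (2 * Real.exp (-(2 * (m + 2) * Real.log n)))) ≤
      1 / (n : ℝ) := by
  have hn0 : (0 : ℝ) < n := by positivity
  have he : Real.exp (-(2 * (m + 2) * Real.log n)) = ((n : ℝ) ^ (2 * (m + 2)))⁻¹ := by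
    rw [Real.exp_neg, show (2 * (m + 2) * Real.log n : ℝ) = ((2 * (m + 2) : ℕ) : ℝ) * Real.log n by
      push_cast; ring, Real.exp_nat_mul, Real.exp_log hn0]
  rw [he, le_div_iff₀ hn0]
  have hnat : 2 * (m * (m + 1)) * n ^ (m + 1) ≤ n ^ (2 * (m + 2)) := by
    calc 2 * (m * (m + 1)) * n ^ (m + 1) ≤ 2 * 2 ^ (m + 2) * n ^ (m + 1) := by
          gcongr; exact mul_succ_le_two_pow m
      _ = 2 ^ (m + 3) * n ^ (m + 1) := by ring
      _ ≤ n ^ (m + 3) * n ^ (m + 1) := by gcongr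
      _ = n ^ (2 * (m + 2)) := by rw [← pow_add]; congr 1; ring
  have hreal : (2 * (m * (m + 1)) * n ^ (m + 1) : ℝ) ≤ (n : ℝ) ^ (2 * (m + 2)) := by
    exact_mod_cast hnat
  have hp : (0 : ℝ) < (n : ℝ) ^ (2 * (m + 2)) := by positivity
  calc (((m + 1) * n ^ m : ℕ) : ℝ) * (m * (2 * ((n : ℝ) ^ (2 * (m + 2)))⁻¹)) * n
      = (2 * (m * (m + 1)) * n ^ (m + 1) : ℝ) / (n : ℝ) ^ (2 * (m + 2)) := by
        push_cast; rw [div_eq_mul_inv]; ring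
    _ ≤ 1 := (div_le_one hp).2 hreal

open Finset in
/-- With probability at least `1 - 1 / n`, the allocation rule applied to an approximately
complementary dual solution of the sample LP is feasible and nearly optimal. -/
theorem one_sub_le_sampleProb_allocation {n m s : ℕ} (hn : 2 ≤ n) {L : LPData n m}
    (hL : L.IsPacking) (hG : L.GeneralPosition) {αd εs ε B : ℝ} (hα : 1 ≤ αd)
    (hα2 : αd ^ 2 ≤ 5 / 4) (hεs : 0 < εs) (hs : s ≤ n) (hsn : (s : ℝ) = εs * n)
    (hε : 0 < ε) (hε1 : ε ≤ 1) (hB : ∀ i, B ≤ L.b i)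
    (hlog : 6 * (m + 2) * Real.log n ≤ ε ^ 2 * (εs * B)) (φ : Sample n s → Fin m → ℝ)
    (hφ : ∀ S, ∃ x ψ, (sampleLP L αd εs ε S).ApproxCompSlack 1 αd x (φ S) ψ) :
    1 - 1 / (n : ℝ) ≤ sampleProb (fun S : Sample n s =>
      L.IsApproxOver L.intFeasible ((1 - 3 * ε) / αd ^ 2) (allocation L (φ S)) ∧
      L.IsApproxOver L.feasible ((1 - 3 * ε) / αd ^ 2) (allocation L (φ S))) := by
  classical
  have hn0 : (0 : ℝ) < n := by positivity
  have hα0 : 0 < αd ^ 2 := by positivity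
  have hα1 : 1 ≤ αd ^ 2 := one_le_pow₀ hα
  have hlog2 : 0.69 < Real.log n :=
    (by linarith [Real.log_two_gt_d9] : 0.69 < Real.log 2).trans_le
      (Real.log_le_log (by norm_num) (by exact_mod_cast hn))
  have hsc : (s / Fintype.card (Fin n) : ℝ) = εs := by
    rw [Fintype.card_fin, hsn]; field_simp
  have hb : ∀ i, 6 * (m + 2) * Real.log n ≤ ε ^ 2 * (εs * L.b i) := fun i =>
    hlog.trans (by gcongr; exact hB i)
  have hml : 0 ≤ (m + 2) * Real.log n := by positivity
  set w : Finset (Fin n) → Fin m → Fin n → ℝ :=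
    fun T i j => L.A i j * if j ∈ T then 1 else 0 with hw
  have hw0 : ∀ T i j, 0 ≤ w T i j := fun T i j =>
    mul_nonneg (hL.A_nonneg i j) (by split_ifs <;> norm_num)
  have hw1 : ∀ T i j, w T i j ≤ 1 := fun T i j => by
    simp only [hw]; split_ifs
    · simpa using hL.A_le_one i j
    · simp
  -- All patterns that any prices can produce. This family is fixed before sampling, so the tail
  -- bounds apply to each member.
  set F : Finset (Finset (Fin n)) :=
    {T | ∃ χ : Fin m → ℝ, ∀ j, j ∈ T ↔ ∑ i, L.A i j * χ i < L.c j} with hF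
  have hFcard : #F ≤ (m + 1) * n ^ m :=
    card_halfspace_patterns_le (by omega) L.A L.c F fun T hT => (mem_filter.1 hT).2
  -- Misleading samples: `T` overloads row `i` globally, yet its sampled load is small. In `high`
  -- below the roles are reversed.
  set low : Finset (Fin n) → Fin m → Finset (Finset (Fin n)) := fun T i =>
    if L.b i < ∑ j, w T i j then
      {S ∈ powersetCard s (univ : Finset (Fin n)) | ∑ j ∈ S, w T i j ≤ (1 - ε) * (εs * L.b i)} else ∅ with hlow
  set high : Finset (Fin n) → Fin m → Finset (Finset (Fin n)) := fun T i =>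
    if ∑ j, w T i j < (1 - 3 * ε) / αd ^ 2 * L.b i then
      {S ∈ powersetCard s (univ : Finset (Fin n)) | (1 - 2 * ε) * (εs * L.b i / αd ^ 2) ≤ ∑ j ∈ S, w T i j}
    else ∅ with hhigh
  set q := Real.exp (-(2 * (m + 2) * Real.log n)) with hq
  have hlowcard : ∀ T i, (#(low T i) : ℝ) ≤ n.choose s * q := by
    intro T i
    simp only [hlow]
    split_ifs with h
    · refine (card_filter_powersetCard_lower_tail (ι := Fin n) (by simpa using hs) (by simp; omega)
        (hw0 T i) (hw1 T i) hε.le hε1 ?_).trans ?_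
      · rw [hsc]; gcongr
      · rw [Fintype.card_fin]
        gcongr
        rw [hq]
        refine Real.exp_le_exp.2 (neg_le_neg ?_)
        linarith [hb i]
    · simp only [card_empty, Nat.cast_zero]; positivity
  have hhighcard : ∀ T i, (#(high T i) : ℝ) ≤ n.choose s * q := by
    intro T i
    simp only [hhigh]
    split_ifs with h
    · have hbi := hL.b_nonneg i
      refine (card_filter_powersetCard_upper_tail (ι := Fin n) (by simpa using hs) (by simp; omega)
        (hw0 T i) (hw1 T i) hε.le hε1 (by positivity) ?_).trans ?_
      · rw [hsc]
        calc εs * ∑ j, w T i j ≤ εs * ((1 - 3 * ε) / αd ^ 2 * L.b i) := by gcongr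
          _ = (1 - 3 * ε) * (εs * L.b i / αd ^ 2) := by ring
      · rw [Fintype.card_fin]
        gcongr
        rw [hq]
        refine Real.exp_le_exp.2 (neg_le_neg ?_)
        rw [show ε ^ 2 * (εs * L.b i / αd ^ 2) / 2 = ε ^ 2 * (εs * L.b i) / (2 * αd ^ 2) by
          field_simp, le_div_iff₀ (by positivity)]
        -- With `αd² ≤ 5/4` the exponent is at least `6 / (2 · 5/4) = 2.4` times `(m + 2) log n`,
        -- which exceeds the required factor `2`.
        nlinarith [hb i, mul_le_mul_of_nonneg_left hα2 hml]
    · simp only [card_empty, Nat.cast_zero]; positivity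
  refine one_sub_le_sampleProb hs (F.biUnion fun T => univ.biUnion fun i => low T i ∪ high T i)
    ?_ ?_
  · intro S hS
    set T : Finset (Fin n) := {j | ∑ i, L.A i j * φ S i < L.c j} with hT
    have hTF : T ∈ F := by
      simp only [hF, mem_filter, mem_univ, true_and]
      exact ⟨φ S, fun j => by simp [hT]⟩
    have hwT : ∀ i j, L.A i j * allocation L (φ S) j = w T i j := by
      intro i j
      simp only [hw, hT, mem_filter, mem_univ, true_and, allocation]
    have hSmem : S.1 ∈ powersetCard s (univ : Finset (Fin n)) :=
      mem_powersetCard.2 ⟨subset_univ _, S.2⟩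
    simp only [mem_biUnion, mem_univ, true_and, mem_union, not_exists, not_and, not_or] at hS
    obtain ⟨x, ψ, hsl⟩ := hφ S
    refine allocation_isApproxOver hL (φ S) hsl.dual_feasible.1 ?_ ?_ ?_
    · rw [div_le_one hα0]; linarith
    · intro i
      by_contra! hlt
      refine (hS T hTF i).1 ?_
      have hload := sample_load_le hL hα S hsl i
      simp only [hwT] at hlt hload
      simp only [hlow, if_pos hlt, mem_filter]
      exact ⟨hSmem, hload⟩
    · intro hβ i hi
      by_contra! hlt
      refine (hS T hTF i).2 ?_
      have hload := le_sample_load hL hG S hsl hi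
      simp only [hwT] at hlt hload
      simp only [hhigh, if_pos hlt, mem_filter]
      refine ⟨hSmem, le_trans ?_ hload⟩
      have hε3 : 3 * ε ≤ 1 := by
        by_contra! h
        exact absurd hβ (not_le.2 (div_neg_of_neg_of_pos (by linarith) hα0))
      -- The loss of `m` from ties costs one more `ε`, turning `1 - ε` into `1 - 2ε`. As `ε ≤ 1/3`,
      -- the hypothesis gives `ε εs b_i ≥ 18 (m + 2) log n`, far above `m αd²`.
      have hm : (m : ℝ) ≤ ε * (εs * L.b i / αd ^ 2) := by
        rw [← mul_div_assoc, le_div_iff₀ hα0]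
        have h1 : ε * (ε * (εs * L.b i)) ≤ 1 / 3 * (ε * (εs * L.b i)) := by
          have := hL.b_nonneg i
          gcongr
          linarith
        have h2 : 0.69 * (m + 2 : ℝ) ≤ (m + 2) * Real.log n := by
          nlinarith [Nat.cast_nonneg (α := ℝ) m]
        have h3 : (m : ℝ) * αd ^ 2 ≤ m * (5 / 4) := by gcongr
        nlinarith [hb i, Nat.cast_nonneg (α := ℝ) m]
      linarith
  · have hchoose : (0 : ℝ) ≤ n.choose s := Nat.cast_nonneg _
    calc ((#(F.biUnion fun T => univ.biUnion fun i => low T i ∪ high T i) : ℕ) : ℝ)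
        ≤ ∑ T ∈ F, ∑ i : Fin m, ((#(low T i) : ℝ) + #(high T i)) := by
          have h1 : #(F.biUnion fun T => univ.biUnion fun i => low T i ∪ high T i) ≤
              ∑ T ∈ F, ∑ i : Fin m, (#(low T i) + #(high T i)) :=
            card_biUnion_le.trans (sum_le_sum fun T _ =>
              card_biUnion_le.trans (sum_le_sum fun i _ => card_union_le _ _))
          exact_mod_cast h1
      _ ≤ ∑ T ∈ F, ∑ i : Fin m, (n.choose s * q + n.choose s * q) :=
          sum_le_sum fun T _ => sum_le_sum fun i _ => add_le_add (hlowcard T i) (hhighcard T i)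
      _ = (#F : ℝ) * (m * (2 * q)) * n.choose s := by
          simp only [sum_const, card_univ, Fintype.card_fin, nsmul_eq_mul]; ring
      _ ≤ (((m + 1) * n ^ m : ℕ) : ℝ) * (m * (2 * q)) * n.choose s := by
          have : (0 : ℝ) ≤ q := (Real.exp_pos _).le
          gcongr
      _ ≤ 1 / (n : ℝ) * n.choose s := by
          gcongr
          exact union_bound_le hn

/-! ### Composition of programs -/

section Programs

variable {p : ℕ} {ι ι' ω ω' : Type}

/-- The cell is filled before round `t`. -/
def Cell.Before (t : ℕ) : Cell p ι → Prop
  | .input _ => True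
  | .computed u _ => u < t

theorem Cell.Before.mono {t u : ℕ} (h : t ≤ u) : ∀ {c : Cell p ι}, c.Before t → c.Before u
  | .input _, _ => trivial
  | .computed _ _, hc => lt_of_lt_of_le hc h

theorem Cell.Before.get_congr {t : ℕ} {x : ι → ℝ} {mem mem' : ℕ → Fin p → ℝ}
    (h : ∀ u < t, mem u = mem' u) : ∀ {c : Cell p ι}, c.Before t → c.get x mem = c.get x mem'
  | .input _, _ => rfl
  | .computed u q, hc => congrFun (h u hc) q

/-- Replacement of inputs by cells, and delay by `off` rounds. -/
def Cell.embed (off : ℕ) (σ : ι' → Cell p ι) : Cell p ι' → Cell p ι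
  | .input i => σ i
  | .computed t q => .computed (t + off) q

/-- Replacement of a cell that has not been filled before round `t` by another one. -/
def Cell.settle (t : ℕ) : Cell p ι → Cell p ι → Cell p ι
  | .input i, _ => .input i
  | .computed u q, z => if u < t then .computed u q else z

theorem Cell.before_settle {t : ℕ} {z : Cell p ι} (hz : z.Before t) :
    ∀ c : Cell p ι, (c.settle t z).Before t
  | .input _ => trivial
  | .computed u q => by
    simp only [Cell.settle]
    split_ifs with h
    · exact h
    · exact hz

/-- A subroutine may output a cell of a round it never ran, which reads the default `0`. The
continuation could later fill that cell, so it is redirected to a cell `z` that holds `0`. -/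
theorem Cell.get_settle {t : ℕ} {z : Cell p ι} {x : ι → ℝ} {mem : ℕ → Fin p → ℝ}
    (hz : z.get x mem = 0) (hmem : ∀ u, t ≤ u → mem u = 0) :
    ∀ c : Cell p ι, (c.settle t z).get x mem = c.get x mem
  | .input _ => rfl
  | .computed u q => by
    simp only [Cell.settle]
    split_ifs with h
    · rfl
    · rw [hz]
      simp [Cell.get, hmem u (not_lt.1 h)]

/-- Renaming of the operands of an instruction. -/
def Instr.map {κ κ' : Type} (g : κ → κ') : Instr κ → Instr κ'
  | .const r => .const r
  | .add a b => .add (g a) (g b)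
  | .sub a b => .sub (g a) (g b)
  | .mul a b => .mul (g a) (g b)
  | .div a b => .div (g a) (g b)
  | .lt a b => .lt (g a) (g b)

theorem Instr.eval_map {κ κ' : Type} (g : κ → κ') (v : κ' → ℝ) (I : Instr κ) :
    (I.map g).eval v = I.eval fun a => v (g a) := by
  cases I <;> rfl

/-- All operands of an instruction satisfy `Q`. -/
def Instr.Forall {κ : Type} (Q : κ → Prop) : Instr κ → Prop
  | .const _ => True
  | .add a b => Q a ∧ Q b
  | .sub a b => Q a ∧ Q b
  | .mul a b => Q a ∧ Q b
  | .div a b => Q a ∧ Q b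
  | .lt a b => Q a ∧ Q b

theorem Instr.Forall.eval_congr {κ : Type} {Q : κ → Prop} {v v' : κ → ℝ}
    (h : ∀ a, Q a → v a = v' a) {I : Instr κ} (hI : I.Forall Q) : I.eval v = I.eval v' := by
  cases I
  · rfl
  all_goals simp only [Instr.eval, h _ hI.1, h _ hI.2]

namespace Program

/-- Run a program as a subroutine started in round `off`, its inputs read from the cells `σ`, and
continue with `k`, which is told the output cells and the current round. -/
def bind (off : ℕ) (σ : ι' → Cell p ι) (z : Cell p ι)
    (k : (ω → Cell p ι) → ℕ → Program p ι ω') : Program p ι' ω → ℕ → Program p ι ω'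
  | halt out, t => k (fun w => ((out w).embed off σ).settle t z) t
  | round ins next, t =>
      round (fun q => (ins q).map (Cell.embed off σ)) fun s => bind off σ z k (next s) (t + 1)

/-- The invariant is that the memory from round `off` on is the subroutine's own memory, shifted.
Thus all values and branches agree, while `σ` and `z`, filled before `off`, are never overwritten.
-/
theorem exec_bind {off : ℕ} {σ : ι' → Cell p ι} {z : Cell p ι}
    (k : (ω → Cell p ι) → ℕ → Program p ι ω') {x : ι → ℝ} {x' : ι' → ℝ}
    (hσb : ∀ i, (σ i).Before off) (hzb : z.Before off) (P : Program p ι' ω) :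
    ∀ (mem' mem : ℕ → Fin p → ℝ) (t : ℕ), (∀ u, mem (u + off) = mem' u) →
      (∀ u, t ≤ u → mem' u = 0) → (∀ i, (σ i).get x mem = x' i) → z.get x mem = 0 →
      ∃ out memB, (bind off σ z k P (t + off)).exec x mem (t + off) =
          (k out ((P.exec x' mem' t).2 + off)).exec x memB ((P.exec x' mem' t).2 + off) ∧
        ∀ w, (out w).get x memB = (P.exec x' mem' t).1 w ∧
          (out w).Before ((P.exec x' mem' t).2 + off) := by
  have hget : ∀ (mem' mem : ℕ → Fin p → ℝ), (∀ u, mem (u + off) = mem' u) →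
      (∀ i, (σ i).get x mem = x' i) →
      ∀ c : Cell p ι', (c.embed off σ).get x mem = c.get x' mem' := by
    intro mem' mem hmem hσ c
    cases c with
    | input i => exact hσ i
    | computed u q => exact congrFun (hmem u) q
  induction P with
  | halt out =>
    intro mem' mem t hmem hzero hσ hz
    refine ⟨_, mem, rfl, fun w => ⟨?_, Cell.before_settle (hzb.mono (Nat.le_add_left _ _)) _⟩⟩
    rw [Cell.get_settle hz]
    · exact hget mem' mem hmem hσ _
    · intro u hu
      obtain ⟨v, rfl⟩ : ∃ v, u = v + off := ⟨u - off, by omega⟩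
      rw [hmem]
      exact hzero v (by omega)
  | round ins next ih =>
    intro mem' mem t hmem hzero hσ hz
    have hev : ∀ q, ((ins q).map (Cell.embed off σ)).eval (Cell.get x mem) =
        (ins q).eval (Cell.get x' mem') := fun q => by
      rw [Instr.eval_map]
      congr 1
      funext c
      exact hget mem' mem hmem hσ c
    simp only [bind, exec, hev]
    rw [show t + off + 1 = t + 1 + off by omega]
    have hlow : ∀ u < off, mem u =
        Function.update mem (t + off) (fun q => (ins q).eval (Cell.get x' mem')) u :=
      fun u hu => (Function.update_of_ne (by omega) _ _).symm
    refine ih _ _ _ (t + 1) ?_ ?_ ?_ ?_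
    · intro u
      rcases eq_or_ne u t with rfl | hne
      · simp
      · rw [Function.update_of_ne (by omega), Function.update_of_ne hne, hmem]
    · intro u hu
      rw [Function.update_of_ne (by omega), hzero u (by omega)]
    · intro i
      rw [← hσ i]
      exact ((hσb i).get_congr hlow).symm
    · rw [← hz]
      exact (hzb.get_congr hlow).symm

/-- `N` rounds of a straight-line program from round `t` on, followed by `k`. -/
def steps (ins : ℕ → Fin p → Instr (Cell p ι)) (k : Program p ι ω) : ℕ → ℕ → Program p ι ω
  | 0, _ => k
  | N + 1, t => round (ins t) fun _ => steps ins k N (t + 1)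

/-- Each cell is written once and read only afterwards, so every instruction can be evaluated in the
final memory `mem'`. Correctness then becomes a recursion on one fixed memory. -/
theorem exec_steps {ins : ℕ → Fin p → Instr (Cell p ι)} (k : Program p ι ω) (x : ι → ℝ)
    (hins : ∀ u q, (ins u q).Forall (Cell.Before u)) (N : ℕ) :
    ∀ (t : ℕ) (mem : ℕ → Fin p → ℝ), ∃ mem', (steps ins k N t).exec x mem t =
        k.exec x mem' (t + N) ∧ (∀ u, u < t ∨ t + N ≤ u → mem' u = mem u) ∧
      ∀ u q, t ≤ u → u < t + N → mem' u q = (ins u q).eval (Cell.get x mem') := by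
  induction N with
  | zero =>
    intro t mem
    exact ⟨mem, rfl, fun _ _ => rfl, fun u q h1 h2 => absurd h2 (by omega)⟩
  | succ N ih =>
    intro t mem
    obtain ⟨mem', h1, h2, h3⟩ :=
      ih (t + 1) (Function.update mem t fun q => (ins t q).eval (Cell.get x mem))
    refine ⟨mem', ?_, fun u hu => ?_, fun u q hu hu' => ?_⟩
    · rw [show t + (N + 1) = t + 1 + N by omega, ← h1]
      rfl
    · rw [h2 u (by omega), Function.update_of_ne (by omega)]
    · rcases hu.eq_or_lt with rfl | hlt
      · rw [h2 t (by omega), Function.update_self]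
        refine (hins t q).eval_congr fun c hc => hc.get_congr fun u hu => ?_
        rw [h2 u (by omega), Function.update_of_ne (by omega)]
      · exact h3 u q hlt (by omega)

end Program

end Programs

/-! ### Implementation of the acceleration algorithm -/

section Acceleration

variable {p n m s : ℕ}

/-- Rounds `0, 1, …, m + 1`: the numbers `0` and `r`, and the scaled right-hand side `r * b`. -/
noncomputable def scaleInstr (q₀ : Fin p) (n m : ℕ) (r : ℝ) (u : ℕ) :
    Instr (Cell p (LPInput n m)) :=
  if u = 0 then .const 0
  else if u = 1 then .const r
  else if h : u - 2 < m then .mul (.computed 1 q₀) (.input (.b ⟨u - 2, h⟩))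
  else .const 0

theorem scaleInstr_before (q₀ : Fin p) (n m : ℕ) (r : ℝ) (u : ℕ) :
    (scaleInstr q₀ n m r u).Forall (Cell.Before u) := by
  unfold scaleInstr
  split_ifs
  · trivial
  · trivial
  · exact ⟨by simp only [Cell.Before]; omega, trivial⟩
  · trivial

/-- The cells holding the input numbers of the sample LP. -/
def sampleCell (q₀ : Fin p) (S : Sample n s) : LPInput s m → Cell p (LPInput n m)
  | .A i k => .input (.A i (S.1.orderEmbOfFin S.2 k))
  | .b i => .computed (i + 2) q₀
  | .c k => .input (.c (S.1.orderEmbOfFin S.2 k))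

/-- The instructions computing the allocation rule from the price cells `φ` from round `t` on:
blocks of `2 m + 2` rounds, and processor `q` treats the variable `r p + q` in block `r`. -/
noncomputable def allocInstr (φ : Fin m → Cell p (LPInput n m)) (t u : ℕ) (q : Fin p) :
    Instr (Cell p (LPInput n m)) :=
  if h : t ≤ u ∧ (u - t) / (2 * m + 2) * p + q < n then
    -- Within a block, round `0` clears the sum, round `2i + 1` forms the `i`-th product, round `2i
    -- + 2` adds it to the partial sum of two rounds before, and round `2m + 1` compares the total
    -- with `c_j`.
    if (u - t) % (2 * m + 2) = 0 then .const 0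
    else if (u - t) % (2 * m + 2) = 2 * m + 1 then
      .lt (.computed (u - 1) q) (.input (.c ⟨_, h.2⟩))
    else if h' : (u - t) % (2 * m + 2) % 2 = 1 ∧ (u - t) % (2 * m + 2) / 2 < m then
      .mul (.input (.A ⟨_, h'.2⟩ ⟨_, h.2⟩)) (φ ⟨_, h'.2⟩)
    else .add (.computed (u - 2) q) (.computed (u - 1) q)
  else .const 0

theorem allocInstr_before {φ : Fin m → Cell p (LPInput n m)} {t : ℕ}
    (hφ : ∀ i, (φ i).Before t) (u : ℕ) (q : Fin p) :
    (allocInstr φ t u q).Forall (Cell.Before u) := by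
  unfold allocInstr
  split_ifs with h h1 h2 h3
  · trivial
  · have : u ≠ 0 := by rintro rfl; simp at h1
    exact ⟨by simp only [Cell.Before]; omega, trivial⟩
  · exact ⟨trivial, (hφ _).mono h.1⟩
  · have : u ≠ 0 := by rintro rfl; simp at h1
    exact ⟨by simp only [Cell.Before]; omega, by simp only [Cell.Before]; omega⟩
  · trivial

/-- The cell holding the `j`-th value of the allocation rule. -/
def allocCell (t : ℕ) (hp : 0 < p) (j : Fin n) : Cell p (LPInput n m) :=
  .computed (t + j / p * (2 * m + 2) + (2 * m + 1)) ⟨j % p, Nat.mod_lt _ hp⟩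

/-- Computation of the allocation rule from the price cells `φ` from round `t` on. -/
noncomputable def allocProgram (hp : 0 < p) (φ : Fin m → Cell p (LPInput n m)) (t : ℕ) :
    Program p (LPInput n m) (Fin n) :=
  .steps (allocInstr φ t) (.halt (allocCell t hp)) ((n ⌈/⌉ p) * (2 * m + 2)) t

theorem exec_allocProgram (hp : 0 < p) (L : LPData n m) {φ : Fin m → Cell p (LPInput n m)}
    {t : ℕ} (hφ : ∀ i, (φ i).Before t) {mem : ℕ → Fin p → ℝ} {χ : Fin m → ℝ}
    (hχ : ∀ i, (φ i).get L.toInput mem = χ i) :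
    (allocProgram hp φ t).exec L.toInput mem t =
      (allocation L χ, t + (n ⌈/⌉ p) * (2 * m + 2)) := by
  obtain ⟨mem', h1, h2, h3⟩ := Program.exec_steps (.halt (allocCell (m := m) (n := n) t hp))
    L.toInput (allocInstr_before hφ) ((n ⌈/⌉ p) * (2 * m + 2)) t mem
  rw [allocProgram, h1, Program.exec]
  refine Prod.ext (funext fun j => ?_) rfl
  have hχ' : ∀ i, (φ i).get L.toInput mem' = χ i := fun i => by
    rw [← hχ i]
    exact (hφ i).get_congr fun u hu => h2 u (Or.inl hu)
  set D := 2 * m + 2 with hD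
  set r := (j : ℕ) / p with hr
  set q : Fin p := ⟨j % p, Nat.mod_lt _ hp⟩ with hq
  have hrj : r * p + q = j := by
    rw [mul_comm]; exact Nat.div_add_mod _ _
  have hrR : r + 1 ≤ n ⌈/⌉ p := by
    rw [Nat.ceilDiv_eq_add_pred_div, hr, Nat.succ_le_iff, Nat.div_lt_iff_lt_mul hp]
    have := Nat.lt_div_mul_add (a := n + p - 1) hp
    have := j.2
    omega
  have hRD : (r + 1) * D ≤ (n ⌈/⌉ p) * D := Nat.mul_le_mul_right _ hrR
  have hstep : ∀ e < D, mem' (t + r * D + e) q =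
      (allocInstr φ t (t + r * D + e) q).eval (Cell.get L.toInput mem') := fun e he =>
    h3 _ _ (by omega) (by rw [add_mul] at hRD; omega)
  have hsub : ∀ e, t + r * D + e - t = e + D * r := fun e => by
    rw [mul_comm D r]; omega
  have hdiv : ∀ e < D, (t + r * D + e - t) / D = r := fun e he => by
    rw [hsub, Nat.add_mul_div_left _ _ (by omega), Nat.div_eq_of_lt he, zero_add]
  have hmod : ∀ e < D, (t + r * D + e - t) % D = e := fun e he => by
    rw [hsub, Nat.add_mul_mod_self_left, Nat.mod_eq_of_lt he]
  have hcond : ∀ e < D, t ≤ t + r * D + e ∧ (t + r * D + e - t) / D * p + q < n := fun e he => by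
    rw [hdiv e he, hrj]
    exact ⟨by omega, j.2⟩
  have hj : ∀ e (he : e < D), (⟨_, (hcond e he).2⟩ : Fin n) = j := fun e he =>
    Fin.ext (by rw [← hrj]; simp only [hdiv e he])
  have hsum : ∀ i ≤ m, mem' (t + r * D + 2 * i) q =
      ∑ l ∈ Finset.range i, if h : l < m then L.A ⟨l, h⟩ j * χ ⟨l, h⟩ else 0 := by
    intro i
    induction i with
    | zero =>
      intro _
      rw [hstep _ (by omega), allocInstr, dif_pos (hcond _ (by omega)), if_pos (hmod _ (by omega))]
      rfl
    | succ i ih =>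
      intro hi
      have e1 : 2 * i + 1 < D := by omega
      have e2 : 2 * i + 2 < D := by omega
      have hmul : mem' (t + r * D + (2 * i + 1)) q = L.A ⟨i, hi⟩ j * χ ⟨i, hi⟩ := by
        have hi' : (t + r * D + (2 * i + 1) - t) % D / 2 = i := by rw [hmod _ e1]; omega
        rw [hstep _ e1, allocInstr, dif_pos (hcond _ e1), if_neg (by rw [hmod _ e1]; omega),
          if_neg (by rw [hmod _ e1]; omega),
          dif_pos ⟨by rw [hmod _ e1]; omega, by rw [hi']; exact hi⟩]
        simp only [Instr.eval, hj _ e1, ← hD, hi', hχ']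
        rfl
      rw [Finset.sum_range_succ, dif_pos (show i < m from hi), ← hmul, ← ih (by omega),
        show 2 * (i + 1) = 2 * i + 2 by ring, hstep _ e2, allocInstr, dif_pos (hcond _ e2),
        if_neg (by rw [hmod _ e2]; omega), if_neg (by rw [hmod _ e2]; omega),
        dif_neg (by rw [hmod _ e2]; omega)]
      rfl
  have e3 : 2 * m + 1 < D := by omega
  have hprice : mem' (t + r * D + 2 * m) q = ∑ i, L.A i j * χ i := by
    rw [hsum m le_rfl, Finset.sum_range]
    exact Finset.sum_congr rfl fun i _ => by rw [dif_pos i.2]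
  change mem' (t + r * D + (2 * m + 1)) q = _
  rw [hstep _ e3, allocInstr, dif_pos (hcond _ e3), if_neg (by rw [hmod _ e3]; omega),
    if_pos (by rw [hmod _ e3])]
  have hpred : t + r * D + (2 * m + 1) - 1 = t + r * D + 2 * m := by omega
  simp only [Instr.eval, Cell.get, LPData.toInput, allocation, hj _ e3, ← hD, hpred, hprice]

/-- The acceleration algorithm as a program. -/
noncomputable def acceleratedProgram (hp : 0 < p) (𝒜 : Solver p) (r : ℝ) (S : Sample n s) :
    Program p (LPInput n m) (Fin n) :=
  .steps (fun u _ => scaleInstr ⟨0, hp⟩ n m r u)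
    (.bind (m + 2) (sampleCell ⟨0, hp⟩ S) (.computed 0 ⟨0, hp⟩)
      (fun out => allocProgram hp fun i => out (.φ i)) (𝒜 s m) (0 + (m + 2))) (m + 2) 0

theorem exec_acceleratedProgram (hp : 0 < p) (𝒜 : Solver p) (αd εs ε : ℝ) (L : LPData n m)
    (S : Sample n s) :
    (acceleratedProgram hp 𝒜 ((1 - ε) * εs / αd) S).exec L.toInput (fun _ _ => 0) 0 =
      (accelerated 𝒜 αd εs ε L S, (𝒜 s m).time (sampleLP L αd εs ε S).toInput + (m + 2) +
        (n ⌈/⌉ p) * (2 * m + 2)) := by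
  set q₀ : Fin p := ⟨0, hp⟩ with hq₀
  rw [acceleratedProgram]
  obtain ⟨mem, h1, h2, h3⟩ := Program.exec_steps
    (.bind (m + 2) (sampleCell q₀ S) (.computed 0 q₀)
      (fun out => allocProgram hp fun i => out (.φ i)) (𝒜 s m) (0 + (m + 2))) L.toInput
    (fun u (_ : Fin p) => scaleInstr_before q₀ n m ((1 - ε) * εs / αd) u) (m + 2) 0
    (fun _ _ => 0)
  rw [h1]
  have hr : mem 1 q₀ = (1 - ε) * εs / αd := by
    rw [h3 1 q₀ (by omega) (by omega)]
    simp [scaleInstr, Instr.eval]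
  -- The constant `0` of round `0` serves as `z`; rounds from `m + 2` on are still blank, as a fresh
  -- run of the solver requires.
  obtain ⟨out, memB, h4, h5⟩ := Program.exec_bind (off := m + 2) (σ := sampleCell q₀ S)
    (z := .computed 0 q₀) (fun out => allocProgram hp fun i => out (.φ i))
    (x := L.toInput) (x' := (sampleLP L αd εs ε S).toInput)
    (fun i => by
      cases i with
      | A i k => trivial
      | b i => exact Nat.add_lt_add_right i.2 2
      | c k => trivial)
    (by simp [Cell.Before]) (𝒜 s m) (fun _ _ => 0) mem 0
    (fun u => by rw [h2 _ (by omega)])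
    (fun _ _ => rfl)
    (fun i => by
      cases i with
      | A i k => rfl
      | c k => rfl
      | b i =>
        change mem (i + 2) q₀ = (1 - ε) * εs / αd * L.b i
        rw [h3 _ _ (by omega) (by omega), scaleInstr, if_neg (by omega), if_neg (by omega),
          dif_pos (by omega)]
        simp only [Instr.eval, Cell.get, hr, LPData.toInput, Nat.add_sub_cancel])
    (by
      change mem 0 q₀ = 0
      rw [h3 0 q₀ (by omega) (by omega)]
      simp [scaleInstr, Instr.eval])
  rw [h4, exec_allocProgram hp L (fun i => (h5 (.φ i)).2) (fun i => (h5 (.φ i)).1)]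
  rfl

theorem acceleratedRunsIn (hp : 0 < p) {αd εs ε : ℝ} (hα : 0 ≤ αd) (hεs : 0 ≤ εs)
    (hεs1 : εs ≤ 1) (hε : ε ≤ 1) {𝒜 : Solver p} {f : ℕ → ℕ → ℕ} (hf : 𝒜.HasRuntime f)
    (hn : 1 ≤ n) (hm : 1 ≤ m) :
    AcceleratedRunsIn 𝒜 n m αd εs ε (f (sampleSize n εs) m + 8 * m * (n ⌈/⌉ p)) := by
  refine ⟨acceleratedProgram hp 𝒜 ((1 - ε) * εs / αd), fun L hL S => ?_⟩
  rw [Program.output, Program.time, exec_acceleratedProgram]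
  refine ⟨rfl, ?_⟩
  have h1 := hf _ m _ (hL.sampleLP hα hεs hε S)
  have h2 : sampleSize n εs ⌈/⌉ p ≤ n ⌈/⌉ p := by
    rw [Nat.ceilDiv_eq_add_pred_div, Nat.ceilDiv_eq_add_pred_div]
    have := sampleSize_le (n := n) hεs1
    exact Nat.div_le_div_right (by omega)
  have h3 : 1 ≤ n ⌈/⌉ p := by
    rw [Nat.ceilDiv_eq_add_pred_div]
    exact (Nat.one_le_div_iff hp).2 (by omega)
  simp only
  -- In units of `m ⌈n/p⌉`, the sampling costs at most `1`, the scaling `m + 2 ≤ 3m` at most `3`,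
  -- and the blocks of length `2m + 2 ≤ 4m` at most `4`: in total `8`.
  nlinarith [Nat.mul_le_mul hm h3]

end Acceleration

/-! ### Assembly of the guarantees -/

theorem sq_le_of_two_mul_pow_four_le {a ε : ℝ} (hε : 0 ≤ ε) (h : 2 * a ^ 4 + a ^ 2 * ε ≤ 3) :
    a ^ 2 ≤ 5 / 4 := by
  by_contra! h'
  nlinarith [mul_nonneg (sq_nonneg a) hε]

theorem mainTheorem2 :
    ∃ C : ℕ, ∀ (p : ℕ), 1 ≤ p → ∀ (αd : ℝ), 1 ≤ αd →
      ∀ (𝒜 : Solver p) (f : ℕ → ℕ → ℕ), 𝒜.IsApproxAlgorithm 1 αd → 𝒜.HasRuntime f →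
      ∀ (n m : ℕ), 1 ≤ n → 1 ≤ m →
      ∀ (εs εf : ℝ), 0 < εs → εs ≤ 1 → (∃ k : ℕ, εs * n = k) → 0 < εf →
        2 * αd ^ 4 + αd ^ 2 * (εf / 3) ≤ 3 →
        AcceleratedRunsIn 𝒜 n m αd εs (εf / 3)
          (f (sampleSize n εs) m + C * m * (n ⌈/⌉ p)) ∧
        ∀ L : LPData n m, L.IsPacking → L.GeneralPosition → 0 < L.minB →
          3 * Real.sqrt (6 * (m + 2) * Real.log n / (εs * L.minB)) ≤ εf →
          (∀ (S : Sample n (sampleSize n εs)) (j : Fin n),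
            accelerated 𝒜 αd εs (εf / 3) L S j = 0 ∨ accelerated 𝒜 αd εs (εf / 3) L S j = 1) ∧
          1 - 1 / (n : ℝ) ≤ sampleProb (fun S : Sample n (sampleSize n εs) =>
            L.IsApproxOver L.intFeasible ((1 - εf) / αd ^ 2) (accelerated 𝒜 αd εs (εf / 3) L S) ∧
            L.IsApproxOver L.feasible ((1 - εf) / αd ^ 2) (accelerated 𝒜 αd εs (εf / 3) L S)) := by
  refine ⟨8, fun p hp αd hα 𝒜 f h𝒜 hf n m hn hm εs εf hεs hεs1 hint hεf hαε => ?_⟩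
  have hα1 : 1 ≤ αd ^ 2 := one_le_pow₀ hα
  have hε1 : εf / 3 ≤ 1 := by nlinarith [one_le_pow₀ hα (n := 4)]
  have hα0 : 0 ≤ αd := by linarith
  refine ⟨acceleratedRunsIn hp hα0 hεs.le hεs1 hε1 hf hn hm, fun L hL hG hB hsqrt =>
    ⟨fun S j => allocation_eq_zero_or_one L _ j, ?_⟩⟩
  -- For `n = 1` the required probability is `0`; the union bound needs `n ≥ 2`.
  rcases hn.eq_or_lt with rfl | hn2
  · rw [Nat.cast_one, div_one, sub_self]
    exact div_nonneg (Nat.cast_nonneg _) (Nat.cast_nonneg _)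
  have hlog : 6 * (m + 2) * Real.log n ≤ (εf / 3) ^ 2 * (εs * L.minB) := by
    rw [← div_le_iff₀ (by positivity)]
    exact Real.sqrt_le_left (by positivity) |>.1 (by linarith)
  have h := one_sub_le_sampleProb_allocation hn2 hL hG hα
    (sq_le_of_two_mul_pow_four_le (by positivity) hαε) hεs (sampleSize_le hεs1)
    (sampleSize_eq hint) (by positivity) hε1
    (fun i => ciInf_le (Set.finite_range L.b).bddBelow i) hlog
    (fun S => 𝒜.φ (sampleLP L αd εs (εf / 3) S))
    (fun S => ⟨_, _, h𝒜 _ m _ (hL.sampleLP hα0 hεs.le hε1 S)⟩)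
  rwa [show 3 * (εf / 3) = εf by ring] at h
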